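/- A surface with $M$ elements assists the downlink from a single-antenna base station to $K$ single-antenna users. Let the channel from the base station to the surface be $g\in\mathbb C^M$, the channel from the surface to user $k$ be $r_k^H$ with $r_k\in\mathbb C^M$, and the direct channel to user $k$ be $h_k\in\mathbb C$, where $$[g]_m=\sqrt{\delta_{BS}}\Big(\sqrt{\tfrac{\kappa_1}{\kappa_1+1}}\,\bar g_m+\sqrt{\tfrac1{\kappa_1+1}}\,\hat g_m\Big),\quad [r_k]_m=\sqrt{\delta_{Sk}}\Big(\sqrt{\tfrac{\kappa_2}{\kappa_2+1}}\,\bar r_{k,m}+\sqrt{\tfrac1{\kappa_2+1}}\,\hat r_{k,m}\Big),\quad h_k=\sqrt{\delta_k}\,\hat h_k .$$ Here the path losses $\delta_{BS},\delta_{Sk},\delta_k$ and the Rician factors $\kappa_1,\kappa_2$ are nonnegative, the line-of-sight components are deterministic with $|\bar g_m|=|\bar r_{k,m}|=1$, and, for each $k$, the variables $\hat h_k,\hat g_1,\dots,\hat g_M,\hat r_{k,1},\dots,\hat r_{k,M}$ are independent circularly symmetric complex Gaussian with mean $0$ and variance $1$. The elements are partitioned into $K$ subsurfaces $\mathcal M_1,\dots,\mathcal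 M_K$, with $|\mathcal M_k|=M_k$; each element of $\mathcal M_k$ operates fully (amplitude $1$) on the side of the surface, transmission or reflection, where user $k$ is located. Put $q_{k,m}=\overline{[r_k]_m}\,[g]_m$. In the PTE (partition-then-estimate) protocol element $m\in\mathcal M_k$ applies the phase shift $\theta_m=\angle h_k-\angle q_{k,m}$ (modulo $2\pi$), which aligns its cascaded channel with the direct link of user $k$, and the signals reaching user $k$ through the other users' subsurfaces are neglected. Then the effective channel of user $k$ is $$h_k+\sum_{m\in\mathcal M_k}q_{k,m}e^{j\theta_m}=e^{j\angle h_k}c_k,\qquad c_k=|h_k|+\sum_{m\in\mathcal M_k}|q_{k,m}|,$$ and $c_k^2$ is integrable, with expected effective channel power gain $$\mathbb E\{c_k^2\}=\delta_k+\delta_{BS}\delta_{Sk}M_k+\frac{\pi^2\delta_{BS}\delta_{Sk}M_k(M_k-1)}{16(\kappa_1+1)(\kappa_2+1)}\big(L_{1/2}(-\kappa_1)L_{1/2}(-\kappa_2)\big)^2+\sqrt{\frac{\pi^3\delta_k\delta_{BS}\delta_{Sk}}{16(\kappa_1+1)(\kappa_2+1)}}\;L_{1/2}(-\kappa_1)L_{1/2}(-\kappa_2)\,M_k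 ,$$ where $L_\nu(x)={}_1F_1(-\nu;1;x)=\sum_{n\ge0}\frac{(-\nu)(-\nu+1)\cdots(-\nu+n-1)}{(n!)^2}x^n$ is the Laguerre function. -/

import Mathlib

open MeasureTheory ProbabilityTheory

/-- The Laguerre function `L_ν(x) = ₁F₁(-ν; 1; x) = ∑ₙ (-ν)ₙ xⁿ / (n!)²` of real degree `ν`, where
`(a)ₙ = a (a + 1) ⋯ (a + n - 1)` (the Laguerre polynomial if `ν` is a natural number). -/
noncomputable def laguerreL (ν x : ℝ) : ℝ :=
  ∑' n : ℕ, (ascPochhammer ℝ n).eval (-ν) / (n.factorial : ℝ) ^ 2 * x ^ n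

/-- The series defining `laguerreL` converges everywhere. -/
theorem summable_laguerreL (ν x : ℝ) :
    Summable fun n : ℕ => (ascPochhammer ℝ n).eval (-ν) / (n.factorial : ℝ) ^ 2 * x ^ n := by
  have hfac : ∀ n : ℕ, (n.factorial : ℝ) ≠ 0 := fun n => by positivity
  have h1 : Filter.Tendsto (fun n : ℕ => (|ν| + 1) * |x| / ((n : ℝ) + 1)) Filter.atTop
      (nhds 0) :=
    Filter.Tendsto.div_atTop tendsto_const_nhds
      (Filter.tendsto_atTop_add_const_right _ _ tendsto_natCast_atTop_atTop)
  refine summable_of_ratio_norm_eventually_le (r := 1 / 2) (by norm_num) ?_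
  filter_upwards [h1.eventually_le_const (show (0 : ℝ) < 1 / 2 by norm_num)] with n hn
  have hrec : (ascPochhammer ℝ (n + 1)).eval (-ν) / ((n + 1).factorial : ℝ) ^ 2 * x ^ (n + 1)
      = ((-ν + n) * x / ((n : ℝ) + 1) ^ 2)
        * ((ascPochhammer ℝ n).eval (-ν) / (n.factorial : ℝ) ^ 2 * x ^ n) := by
    have := hfac n
    have hn1 : (n : ℝ) + 1 ≠ 0 := by positivity
    rw [ascPochhammer_succ_eval, Nat.factorial_succ]
    push_cast
    field_simp
    ring
  rw [hrec, norm_mul]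
  refine mul_le_mul_of_nonneg_right (le_trans ?_ hn) (norm_nonneg _)
  have hn1 : (0 : ℝ) < (n : ℝ) + 1 := by positivity
  rw [Real.norm_eq_abs, abs_div, abs_mul, abs_of_pos (pow_pos hn1 2),
    div_le_div_iff₀ (pow_pos hn1 2) hn1]
  have h2 : |-ν + n| ≤ (|ν| + 1) * ((n : ℝ) + 1) := by
    have h3 : |-ν + n| ≤ |ν| + n := by
      have := abs_add_le (-ν) (n : ℝ)
      rwa [abs_neg, Nat.abs_cast] at this
    nlinarith [abs_nonneg ν, (Nat.cast_nonneg n : (0 : ℝ) ≤ n),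
      mul_nonneg (abs_nonneg ν) (Nat.cast_nonneg n : (0 : ℝ) ≤ n)]
  calc |-ν + n| * |x| * ((n : ℝ) + 1)
      ≤ (|ν| + 1) * ((n : ℝ) + 1) * |x| * ((n : ℝ) + 1) := by gcongr
    _ = (|ν| + 1) * |x| * ((n : ℝ) + 1) ^ 2 := by ring

/-- The circularly symmetric complex Gaussian law `CN(μ, v)`: real and imaginary parts are
independent real Gaussians, each of variance `v / 2`, centred at those of `μ`. -/
noncomputable def cscg (μ : ℂ) (v : NNReal) : Measure ℂ :=
  ((gaussianReal μ.re (v / 2)).prod (gaussianReal μ.im (v / 2))).map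
    fun p : ℝ × ℝ => (⟨p.1, p.2⟩ : ℂ)

/-- The two half-spaces served by the surface. -/
inductive Side where
  | transmission
  | reflection

/-- The deterministic (long-term) data of a STAR-RIS aided downlink with `K` users and `M`
surface elements, whose elements have been partitioned into one subsurface per user. -/
structure StarRIS (K M : ℕ) where
  /-- the region in which each user is located -/
  side : Fin K → Side
  /-- the user to whose subsurface each element belongs -/
  owner : Fin M → Fin K
  /-- path loss of the link from the base station to the surface -/
  δBS : ℝ
  /-- path losses of the links from the surface to the users -/
  δS : Fin K → ℝ
  /-- path losses of the direct links from the base station to the users -/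
  δ : Fin K → ℝ
  /-- Rician factor of the link from the base station to the surface -/
  κ₁ : ℝ
  /-- Rician factor of the links from the surface to the users -/
  κ₂ : ℝ
  /-- line-of-sight component of the link from the base station to the surface -/
  gLoS : Fin M → ℂ
  /-- line-of-sight components of the links from the surface to the users -/
  rLoS : Fin K → Fin M → ℂ
  δBS_nonneg : 0 ≤ δBS
  δS_nonneg : ∀ k, 0 ≤ δS k
  δ_nonneg : ∀ k, 0 ≤ δ k
  κ₁_nonneg : 0 ≤ κ₁
  κ₂_nonneg : 0 ≤ κ₂
  norm_gLoS : ∀ m, ‖gLoS m‖ = 1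
  norm_rLoS : ∀ k m, ‖rLoS k m‖ = 1

/-- The random non-line-of-sight fading coefficients, as functions on a sample space. -/
structure Fading (Ω : Type*) (K M : ℕ) where
  /-- surface elements, seen from the base station -/
  gHat : Fin M → Ω → ℂ
  /-- users, seen from the surface elements -/
  rHat : Fin K → Fin M → Ω → ℂ
  /-- users, seen from the base station -/
  hHat : Fin K → Ω → ℂ

namespace Fading

variable {Ω : Type*} {K M : ℕ}

/-- All fading coefficients that enter the channel of user `k`: the direct one, those between the
base station and the elements, and those between the elements and user `k`. -/
def forUser (F : Fading Ω K M) (k : Fin K) : Unit ⊕ Fin M ⊕ Fin M → Ω → ℂ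
  | Sum.inl _ => F.hHat k
  | Sum.inr (Sum.inl m) => F.gHat m
  | Sum.inr (Sum.inr m) => F.rHat k m

/-- The small-scale fading law: each coefficient is `CN(0, 1)`, and for each user the
coefficients entering that user's channel are mutually independent. -/
structure IsCSCG [MeasurableSpace Ω] (F : Fading Ω K M) (P : Measure Ω) : Prop where
  law : ∀ k i, HasLaw (F.forUser k i) (cscg 0 1) P
  indep : ∀ k, iIndepFun (F.forUser k) P

end Fading

namespace StarRIS

variable {Ω : Type*} {K M : ℕ} (S : StarRIS K M) (F : Fading Ω K M)

/-- Rician channel from the base station to element `m`. -/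
noncomputable def g (m : Fin M) (ω : Ω) : ℂ :=
  √S.δBS * (√(S.κ₁ / (S.κ₁ + 1)) * S.gLoS m + √(1 / (S.κ₁ + 1)) * F.gHat m ω)

/-- The `m`-th entry of the Rician channel vector `r_k`; the channel from element `m` to user `k`
is its complex conjugate. -/
noncomputable def r (k : Fin K) (m : Fin M) (ω : Ω) : ℂ :=
  √(S.δS k) * (√(S.κ₂ / (S.κ₂ + 1)) * S.rLoS k m + √(1 / (S.κ₂ + 1)) * F.rHat k m ω)

/-- Rayleigh direct channel from the base station to user `k`. -/
noncomputable def h (k : Fin K) (ω : Ω) : ℂ := √(S.δ k) * F.hHat k ω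

/-- Cascaded channel from the base station to user `k` through element `m` (before the element's
phase shift is applied). -/
noncomputable def q (k : Fin K) (m : Fin M) (ω : Ω) : ℂ :=
  starRingEnd ℂ (S.r F k m ω) * S.g F m ω

/-- The subsurface of user `k`. -/
def subsurface (k : Fin K) : Finset (Fin M) := Finset.univ.filter fun m => S.owner m = k

/-- The number `M_k` of elements of the subsurface of user `k`. -/
def size (k : Fin K) : ℕ := (S.subsurface k).card

open Classical in
/-- Mode switching: element `m` operates on side `s` (amplitude `1`, otherwise `0`) if the user
it is assigned to is located there. -/
noncomputable def β (s : Side) (m : Fin M) : ℝ := if S.side (S.owner m) = s then 1 else 0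

/-- The aligned phase shift (modulo `2π`) of element `m`: it rotates the cascaded channel, through
that element, of the user it is assigned to onto that user's direct channel. -/
noncomputable def θ (m : Fin M) (ω : Ω) : ℝ :=
  (S.h F (S.owner m) ω).arg - (S.q F (S.owner m) m ω).arg

/-- The transmission / reflection coefficient of element `m` on side `s`. -/
noncomputable def v (s : Side) (m : Fin M) (ω : Ω) : ℂ :=
  √(S.β s m) * Complex.exp (Complex.I * S.θ F m ω)

/-- Signal received by user `k` through the subsurface of user `j`. -/
noncomputable def via (j k : Fin K) (ω : Ω) : ℂ :=
  ∑ m ∈ S.subsurface j, S.q F k m ω * S.v F (S.side k) m ω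

/-- The PTE effective channel of user `k`: the direct channel plus the signal through the user's
own subsurface, the signals scattered by the other users' subsurfaces being neglected. -/
noncomputable def channel (k : Fin K) (ω : Ω) : ℂ := S.h F k ω + S.via F k k ω

/-- The PTE effective channel `c_k = |h_k| + ∑_{m in subsurface k} |q_{k,m}|` of user `k` after
phase alignment, up to the common phase of the direct link. -/
noncomputable def c (k : Fin K) (ω : Ω) : ℝ :=
  ‖S.h F k ω‖ + ∑ m ∈ S.subsurface k, ‖S.q F k m ω‖

end StarRIS

/-! The phase shifts align every path, so `c` is a sum of pairwise independent square-integrable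
moduli: the direct one and one product of two moduli per element. Its second moment needs only their
first two moments (`integral_add_sum_sq_of_indepFun`). The second moments are elementary; the real
content is the Rice mean `integral_norm_add_cscg`.

For that mean, write `√(π a) = ∫₀^∞ (1 - exp(-a x²)) / x² dx` with `a = ‖s + z‖²` and apply Fubini.
The expectation over `z` is then a Gaussian Laplace transform at `t = x²`, leaving an explicit
integral in `x`. Expanding its exponential and integrating termwise against `x^(2n) / (1 +
x²)^(n+2)` yields the Laguerre series. -/

/-! ### Rational integrals on the half-line -/

theorem integrable_pow_div_one_add_sq_pow (n : ℕ) :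
    Integrable fun x : ℝ => x ^ (2 * n) / (1 + x ^ 2) ^ (n + 2) := by
  refine integrable_inv_one_add_sq.mono' (Measurable.aestronglyMeasurable (by fun_prop)) ?_
  refine Filter.Eventually.of_forall fun x => ?_
  have h1 : (1 : ℝ) ≤ 1 + x ^ 2 := by nlinarith [sq_nonneg x]
  have h2 : x ^ (2 * n) ≤ (1 + x ^ 2) ^ n := by
    rw [pow_mul]
    exact pow_le_pow_left₀ (sq_nonneg x) (by linarith) n
  rw [Real.norm_of_nonneg (div_nonneg (by rw [pow_mul]; positivity) (by positivity)),
    div_le_iff₀ (by positivity), pow_succ (1 + x ^ 2) (n + 1), pow_succ (1 + x ^ 2) n]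
  have h3 : (1 + x ^ 2)⁻¹ * ((1 + x ^ 2) ^ n * (1 + x ^ 2) * (1 + x ^ 2))
      = (1 + x ^ 2) ^ n * (1 + x ^ 2) := by field_simp
  rw [h3]
  nlinarith [pow_pos (zero_lt_one.trans_le h1) n]

theorem tendsto_pow_div_one_add_sq_pow (n : ℕ) :
    Filter.Tendsto (fun x : ℝ => x ^ (2 * n + 1) / (1 + x ^ 2) ^ (n + 1)) Filter.atTop (nhds 0) := by
  refine tendsto_of_tendsto_of_tendsto_of_le_of_le' tendsto_const_nhds tendsto_inv_atTop_zero ?_ ?_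
  · filter_upwards [Filter.eventually_gt_atTop 0] with x hx
    positivity
  · filter_upwards [Filter.eventually_gt_atTop 0] with x hx
    rw [div_le_iff₀ (by positivity), inv_mul_eq_div, le_div_iff₀ hx, ← pow_succ,
      show 2 * n + 1 + 1 = 2 * (n + 1) by ring, pow_mul]
    exact pow_le_pow_left₀ (sq_nonneg x) (by linarith) _

/-- The derivative of `x / (1 + x²)` is `2 / (1 + x²)² - 1 / (1 + x²)`, and its boundary values
vanish. -/
theorem integral_one_div_one_add_sq_sq :
    ∫ x in Set.Ioi (0 : ℝ), x ^ (2 * 0) / (1 + x ^ 2) ^ (0 + 2) = Real.pi / 4 := by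
  have hi := (integrable_pow_div_one_add_sq_pow 0).integrableOn (s := Set.Ioi 0)
  have hj := integrable_inv_one_add_sq.integrableOn (s := Set.Ioi 0)
  have key := integral_Ioi_of_hasDerivAt_of_tendsto' (a := 0)
    (f := fun x : ℝ => x ^ (2 * 0 + 1) / (1 + x ^ 2) ^ (0 + 1))
    (f' := fun x : ℝ => 2 * (x ^ (2 * 0) / (1 + x ^ 2) ^ (0 + 2)) - (1 + x ^ 2)⁻¹)
    (m := 0) (fun x _ => ?_) ((hi.const_mul 2).sub' hj) (tendsto_pow_div_one_add_sq_pow 0)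
  · rw [integral_sub (hi.const_mul 2) hj, integral_const_mul, integral_Ioi_inv_one_add_sq] at key
    simp only [Real.arctan_zero] at key
    norm_num at key ⊢
    linarith
  · have h0 : (1 : ℝ) + x ^ 2 ≠ 0 := by positivity
    have h1 : HasDerivAt (fun x : ℝ => (1 + x ^ 2) ^ (0 + 1)) (2 * x) x := by
      simpa using ((hasDerivAt_pow 2 x).const_add 1)
    refine ((hasDerivAt_pow (2 * 0 + 1) x).fun_div h1 (by simpa using h0)).congr_deriv ?_
    simp
    field_simp
    ring

/-- Integration by parts: differentiating `x^(2n+1) / (1 + x²)^(n+2)`, which vanishes at `0` and at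
infinity, relates consecutive integrals. -/
theorem integral_pow_div_one_add_sq_pow_succ (n : ℕ) :
    ∫ x in Set.Ioi (0 : ℝ), x ^ (2 * (n + 1)) / (1 + x ^ 2) ^ (n + 1 + 2)
      = (2 * (n : ℝ) + 1) / (2 * ((n : ℝ) + 2))
        * ∫ x in Set.Ioi (0 : ℝ), x ^ (2 * n) / (1 + x ^ 2) ^ (n + 2) := by
  have hi := (integrable_pow_div_one_add_sq_pow n).integrableOn (s := Set.Ioi 0)
  have hj := (integrable_pow_div_one_add_sq_pow (n + 1)).integrableOn (s := Set.Ioi 0)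
  have hlim : Filter.Tendsto (fun x : ℝ => x ^ (2 * n + 1) / (1 + x ^ 2) ^ (n + 2))
      Filter.atTop (nhds 0) := by
    refine squeeze_zero' ?_ ?_ (tendsto_pow_div_one_add_sq_pow n)
    · filter_upwards [Filter.eventually_gt_atTop 0] with x hx
      positivity
    · filter_upwards [Filter.eventually_gt_atTop 0] with x hx
      exact div_le_div_of_nonneg_left (by positivity) (by positivity)
        (pow_le_pow_right₀ (by nlinarith) (by omega))
  have key := integral_Ioi_of_hasDerivAt_of_tendsto' (a := 0)
    (f := fun x : ℝ => x ^ (2 * n + 1) / (1 + x ^ 2) ^ (n + 2))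
    (f' := fun x : ℝ => (2 * n + 1) * (x ^ (2 * n) / (1 + x ^ 2) ^ (n + 2))
      - (2 * (n + 2)) * (x ^ (2 * (n + 1)) / (1 + x ^ 2) ^ (n + 1 + 2)))
    (m := 0) (fun x _ => ?_) ((hi.const_mul _).sub' (hj.const_mul _)) hlim
  · rw [integral_sub (hi.const_mul _) (hj.const_mul _), integral_const_mul, integral_const_mul]
      at key
    simp only [ne_eq, Nat.add_eq_zero_iff, one_ne_zero, and_false, not_false_eq_true, zero_pow,
      zero_div, sub_zero] at key
    have hn : (2 * ((n : ℝ) + 2)) ≠ 0 := by positivity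
    rw [div_mul_eq_mul_div, eq_div_iff hn]
    linarith
  · have h0 : (1 : ℝ) + x ^ 2 ≠ 0 := by positivity
    have h1 : HasDerivAt (fun x : ℝ => (1 + x ^ 2) ^ (n + 2))
        ((n + 2 : ℕ) * (1 + x ^ 2) ^ (n + 1) * (2 * x)) x := by
      simpa using ((hasDerivAt_pow 2 x).const_add 1).fun_pow (n + 2)
    refine ((hasDerivAt_pow (2 * n + 1) x).fun_div h1 (pow_ne_zero _ h0)).congr_deriv ?_
    simp only [Nat.add_sub_cancel]
    push_cast
    field_simp
    ring

/-- The recursion factor is `(-1/2 + (n+1)) / (n+2)`, the ratio of consecutive values of `(-1/2)ₙ₊₁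
/ (n+1)!`. -/
theorem integral_pow_div_one_add_sq_pow (n : ℕ) :
    ∫ x in Set.Ioi (0 : ℝ), x ^ (2 * n) / (1 + x ^ 2) ^ (n + 2)
      = -(Real.pi / 2) * ((ascPochhammer ℝ (n + 1)).eval (-(1 / 2)) / ((n + 1).factorial : ℝ)) := by
  induction n with
  | zero =>
    rw [integral_one_div_one_add_sq_sq]
    simp
    ring
  | succ n ih =>
    rw [integral_pow_div_one_add_sq_pow_succ, ih, ascPochhammer_succ_eval (n + 1),
      Nat.factorial_succ (n + 1)]
    have := Nat.factorial_ne_zero (n + 1)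
    push_cast
    field_simp
    ring

/-! ### Integral representation of the Laguerre function -/

theorem hasSum_neg_pow_div_factorial_mul_pow_div_one_add_sq_pow (κ : ℝ) {x : ℝ} (hx : x ≠ 0) :
    HasSum (fun n : ℕ => -((-κ) ^ (n + 1) / ((n + 1).factorial : ℝ))
        * (x ^ (2 * n) / (1 + x ^ 2) ^ (n + 2)))
      (-(x ^ 2 * (1 + x ^ 2))⁻¹ * (Real.exp (-(κ * (x ^ 2 / (1 + x ^ 2)))) - 1)) := by
  have h0 : (1 : ℝ) + x ^ 2 ≠ 0 := by positivity
  have hexp : HasSum (fun n : ℕ => (-(κ * (x ^ 2 / (1 + x ^ 2)))) ^ n / (n.factorial : ℝ))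
      (Real.exp (-(κ * (x ^ 2 / (1 + x ^ 2))))) := by
    rw [Real.exp_eq_exp_ℝ]
    exact NormedSpace.expSeries_div_hasSum_exp _
  have hexp' := ((hasSum_nat_add_iff' 1).2 hexp).mul_left (-(x ^ 2 * (1 + x ^ 2))⁻¹)
  simp only [Finset.range_one, Finset.sum_singleton, pow_zero, Nat.factorial_zero, Nat.cast_one,
    div_one] at hexp'
  have hterm : ∀ n : ℕ, -((-κ) ^ (n + 1) / ((n + 1).factorial : ℝ))
        * (x ^ (2 * n) / (1 + x ^ 2) ^ (n + 2))
      = -(x ^ 2 * (1 + x ^ 2))⁻¹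
        * ((-(κ * (x ^ 2 / (1 + x ^ 2)))) ^ (n + 1) / ((n + 1).factorial : ℝ)) := by
    intro n
    have := Nat.factorial_ne_zero (n + 1)
    rw [← neg_mul, mul_pow, div_pow, pow_mul]
    generalize (-κ) ^ (n + 1) = z
    field_simp
    ring
  simpa only [hterm] using hexp'

theorem integral_neg_pow_div_factorial_mul_pow_div_one_add_sq_pow (κ : ℝ) (n : ℕ) :
    ∫ x in Set.Ioi (0 : ℝ), -((-κ) ^ (n + 1) / ((n + 1).factorial : ℝ))
        * (x ^ (2 * n) / (1 + x ^ 2) ^ (n + 2))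
      = Real.pi / 2 * ((ascPochhammer ℝ (n + 1)).eval (-(1 / 2)) / ((n + 1).factorial : ℝ) ^ 2
        * (-κ) ^ (n + 1)) := by
  rw [integral_const_mul, integral_pow_div_one_add_sq_pow]
  have := Nat.factorial_ne_zero (n + 1)
  generalize (-κ) ^ (n + 1) = z
  field_simp

/-- Each term has constant sign, so the absolute convergence needed to swap sum and integral is that
of the Laguerre series. -/
theorem integral_norm_neg_pow_div_factorial_mul_pow_div_one_add_sq_pow (κ : ℝ) (n : ℕ) :
    ∫ x in Set.Ioi (0 : ℝ), ‖-((-κ) ^ (n + 1) / ((n + 1).factorial : ℝ))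
        * (x ^ (2 * n) / (1 + x ^ 2) ^ (n + 2))‖
      = ‖Real.pi / 2 * ((ascPochhammer ℝ (n + 1)).eval (-(1 / 2)) / ((n + 1).factorial : ℝ) ^ 2
        * (-κ) ^ (n + 1))‖ := by
  have hpos : ∀ x : ℝ, 0 ≤ x ^ (2 * n) / (1 + x ^ 2) ^ (n + 2) := fun x =>
    div_nonneg (by rw [pow_mul]; positivity) (by positivity)
  rw [← integral_neg_pow_div_factorial_mul_pow_div_one_add_sq_pow]
  simp only [norm_mul, integral_const_mul]
  congr 1
  rw [Real.norm_of_nonneg (integral_nonneg hpos)]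
  simp only [Real.norm_of_nonneg (hpos _)]

/-- The Laguerre function of degree `1 / 2` as an integral. -/
theorem integral_one_sub_exp_div_sq_eq_laguerreL {κ : ℝ} (hκ : 0 ≤ κ) :
    ∫ x in Set.Ioi (0 : ℝ), (1 - (1 + x ^ 2)⁻¹ * Real.exp (-(κ * (x ^ 2 / (1 + x ^ 2))))) / x ^ 2
      = Real.pi / 2 * laguerreL (1 / 2) (-κ) := by
  let F : ℕ → ℝ → ℝ := fun n x => -((-κ) ^ (n + 1) / ((n + 1).factorial : ℝ))
    * (x ^ (2 * n) / (1 + x ^ 2) ^ (n + 2))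
  let G : ℝ → ℝ := fun x =>
    -(x ^ 2 * (1 + x ^ 2))⁻¹ * (Real.exp (-(κ * (x ^ 2 / (1 + x ^ 2)))) - 1)
  have hc := summable_laguerreL (1 / 2) (-κ)
  have hc' := (summable_nat_add_iff 1).2 hc
  have hF : ∀ n, IntegrableOn (F n) (Set.Ioi 0) := fun n =>
    ((integrable_pow_div_one_add_sq_pow n).integrableOn).const_mul _
  have hFnorm : Summable fun n => ∫ x in Set.Ioi 0, ‖F n x‖ := by
    simp only [F, integral_norm_neg_pow_div_factorial_mul_pow_div_one_add_sq_pow]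
    exact (hc'.mul_left (Real.pi / 2)).norm
  have hFG : ∀ x ∈ Set.Ioi (0 : ℝ), ∑' n, F n x = G x := fun x hx =>
    (hasSum_neg_pow_div_factorial_mul_pow_div_one_add_sq_pow κ (ne_of_gt hx)).tsum_eq
  have hGint : ∫ x in Set.Ioi 0, G x = Real.pi / 2 * (laguerreL (1 / 2) (-κ) - 1) := by
    rw [← setIntegral_congr_fun measurableSet_Ioi hFG,
      ← integral_tsum_of_summable_integral_norm hF hFnorm, laguerreL, hc.tsum_eq_zero_add]
    simp only [F, integral_neg_pow_div_factorial_mul_pow_div_one_add_sq_pow, tsum_mul_left]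
    simp
  -- Since `0 ≤ 1 - exp(-u) ≤ u` for `u ≥ 0`, `G` lies between `0` and `κ / (1 + x²)`.
  have hG : IntegrableOn G (Set.Ioi 0) := by
    refine (integrable_inv_one_add_sq.integrableOn.const_mul κ).mono'
      (Measurable.aestronglyMeasurable (by fun_prop)) ?_
    filter_upwards [self_mem_ae_restrict measurableSet_Ioi] with x hx
    have hx2 : 0 < x ^ 2 := pow_pos hx 2
    have h1 := Real.add_one_le_exp (-(κ * (x ^ 2 / (1 + x ^ 2))))
    have h2 : Real.exp (-(κ * (x ^ 2 / (1 + x ^ 2)))) ≤ 1 :=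
      Real.exp_le_one_iff.2 (neg_nonpos.2 (by positivity))
    have h3 : G x = (1 - Real.exp (-(κ * (x ^ 2 / (1 + x ^ 2))))) / (x ^ 2 * (1 + x ^ 2)) := by
      simp only [G]
      ring
    have h4 : κ * (x ^ 2 / (1 + x ^ 2)) ≤ κ * x ^ 2 :=
      mul_le_mul_of_nonneg_left (div_le_self hx2.le (by linarith)) hκ
    rw [h3, Real.norm_of_nonneg (div_nonneg (by linarith) (by positivity)),
      div_le_iff₀ (by positivity)]
    have h5 : κ * (1 + x ^ 2)⁻¹ * (x ^ 2 * (1 + x ^ 2)) = κ * x ^ 2 := by field_simp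
    rw [h5]
    linarith
  -- The summand `(1 + x²)⁻¹` integrates to `π / 2` and restores the zeroth Laguerre term, absent
  -- from `G`.
  have hsplit : Set.EqOn
      (fun x => (1 - (1 + x ^ 2)⁻¹ * Real.exp (-(κ * (x ^ 2 / (1 + x ^ 2))))) / x ^ 2)
      (fun x => (1 + x ^ 2)⁻¹ + G x) (Set.Ioi 0) := by
    intro x hx
    have hx0 : x ≠ 0 := ne_of_gt hx
    have h0 : (1 : ℝ) + x ^ 2 ≠ 0 := by positivity
    simp only [G]
    generalize Real.exp (-(κ * (x ^ 2 / (1 + x ^ 2)))) = z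
    field_simp
    ring
  rw [setIntegral_congr_fun measurableSet_Ioi hsplit,
    integral_add integrable_inv_one_add_sq.integrableOn hG, hGint, integral_Ioi_inv_one_add_sq]
  simp
  ring

/-! ### Square root as an integral of exponentials -/

theorem one_sub_exp_neg_mul_sq_div_sq_nonneg {a : ℝ} (ha : 0 ≤ a) (x : ℝ) :
    0 ≤ (1 - Real.exp (-(a * x ^ 2))) / x ^ 2 :=
  div_nonneg (sub_nonneg.2 (Real.exp_le_one_iff.2 (by nlinarith [mul_nonneg ha (sq_nonneg x)])))
    (sq_nonneg x)

theorem integrable_one_sub_exp_neg_mul_sq_div_sq {a : ℝ} (ha : 0 ≤ a) :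
    Integrable fun x : ℝ => (1 - Real.exp (-(a * x ^ 2))) / x ^ 2 := by
  refine (integrable_inv_one_add_sq.const_mul (a + 1)).mono'
    (Measurable.aestronglyMeasurable (by fun_prop)) (Filter.Eventually.of_forall fun x => ?_)
  rw [Real.norm_of_nonneg (one_sub_exp_neg_mul_sq_div_sq_nonneg ha x)]
  rcases eq_or_ne x 0 with rfl | hx
  · simp
    linarith
  · have h1 := Real.add_one_le_exp (-(a * x ^ 2))
    have h2 := Real.exp_pos (-(a * x ^ 2))
    have hx2 : 0 < x ^ 2 := by positivity
    rw [div_le_iff₀ hx2, mul_right_comm, ← div_eq_mul_inv, le_div_iff₀ (by positivity)]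
    nlinarith [mul_nonneg h2.le hx2.le]

/-- Subordination formula for the square root. -/
theorem integral_one_sub_exp_neg_mul_sq_div_sq {a : ℝ} (ha : 0 ≤ a) :
    ∫ x in Set.Ioi (0 : ℝ), (1 - Real.exp (-(a * x ^ 2))) / x ^ 2 = √(Real.pi * a) := by
  rcases ha.eq_or_lt with rfl | ha'
  · simp
  have hi := (integrable_one_sub_exp_neg_mul_sq_div_sq ha).integrableOn (s := Set.Ioi 0)
  have hj : IntegrableOn (fun x : ℝ => Real.exp (-a * x ^ 2)) (Set.Ioi 0) :=
    (integrable_exp_neg_mul_sq ha').integrableOn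
  have hsmall : ∀ x : ℝ, |(1 - Real.exp (-(a * x ^ 2))) / x| ≤ a * |x| := by
    intro x
    rcases eq_or_ne x 0 with rfl | hx
    · simp
    have h1 := Real.add_one_le_exp (-(a * x ^ 2))
    have h2 : Real.exp (-(a * x ^ 2)) ≤ 1 := Real.exp_le_one_iff.2 (by
      nlinarith [mul_nonneg ha (sq_nonneg x)])
    rw [abs_div, div_le_iff₀ (abs_pos.2 hx), abs_of_nonneg (by linarith), mul_assoc,
      abs_mul_abs_self]
    nlinarith
  -- The convention `0 / 0 = 0` agrees with the limit, so the boundary value at `0` is zero.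
  have hcont : ContinuousAt (fun x : ℝ => (1 - Real.exp (-(a * x ^ 2))) / x) 0 := by
    rw [ContinuousAt]
    simp only [div_zero]
    refine squeeze_zero_norm hsmall ?_
    have : Continuous fun x : ℝ => a * |x| := by fun_prop
    simpa using this.tendsto 0
  have hlim : Filter.Tendsto (fun x : ℝ => (1 - Real.exp (-(a * x ^ 2))) / x) Filter.atTop
      (nhds 0) := by
    refine squeeze_zero' ?_ ?_ tendsto_inv_atTop_zero
    · filter_upwards [Filter.eventually_gt_atTop 0] with x hx
      exact div_nonneg (sub_nonneg.2 (Real.exp_le_one_iff.2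
        (by nlinarith [mul_nonneg ha (sq_nonneg x)]))) hx.le
    · filter_upwards [Filter.eventually_gt_atTop 0] with x hx
      rw [← one_div]
      exact div_le_div_of_nonneg_right (by linarith [Real.exp_pos (-(a * x ^ 2))]) hx.le
  -- With both boundary values zero, the integral equals `2a ∫₀^∞ exp(-a x²) dx`.
  have key := integral_Ioi_of_hasDerivAt_of_tendsto (a := 0)
    (f := fun x : ℝ => (1 - Real.exp (-(a * x ^ 2))) / x)
    (f' := fun x : ℝ => 2 * a * Real.exp (-a * x ^ 2) - (1 - Real.exp (-(a * x ^ 2))) / x ^ 2)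
    (m := 0) hcont.continuousWithinAt (fun x hx => ?_) ((hj.const_mul _).sub' hi) hlim
  · rw [integral_sub (hj.const_mul _) hi, integral_const_mul, integral_gaussian_Ioi] at key
    simp only [div_zero, sub_zero] at key
    rw [← sub_eq_zero.1 key, Real.sqrt_div Real.pi_pos.le, Real.sqrt_mul Real.pi_pos.le]
    have := Real.sq_sqrt ha
    have h3 : √a ≠ 0 := (Real.sqrt_pos.2 ha').ne'
    field_simp
    nlinarith
  · have hx0 : x ≠ 0 := ne_of_gt hx
    have h1 : HasDerivAt (fun x : ℝ => 1 - Real.exp (-(a * x ^ 2)))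
        (-(Real.exp (-(a * x ^ 2)) * (-(a * (2 * x))))) x := by
      simpa using (((hasDerivAt_pow 2 x).const_mul a).neg.exp).const_sub 1
    refine (h1.fun_div (hasDerivAt_id' x) hx0).congr_deriv ?_
    simp only [neg_mul]
    field_simp

/-! ### Moments of a shifted complex Gaussian modulus -/

theorem measurable_complex_mk : Measurable fun p : ℝ × ℝ => (⟨p.1, p.2⟩ : ℂ) :=
  Complex.measurableEquivRealProd.symm.measurable

instance isProbabilityMeasure_cscg (μ : ℂ) (v : NNReal) : IsProbabilityMeasure (cscg μ v) :=
  Measure.isProbabilityMeasure_map measurable_complex_mk.aemeasurable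

theorem integral_cscg {f : ℂ → ℝ} (hf : Measurable f) :
    ∫ z, f z ∂cscg 0 1
      = ∫ p, f ⟨p.1, p.2⟩ ∂(gaussianReal 0 (1 / 2)).prod (gaussianReal 0 (1 / 2)) := by
  rw [cscg, integral_map measurable_complex_mk.aemeasurable hf.aestronglyMeasurable]
  simp

/-- Complete the square: `x² + t(s + x)² = (1 + t)(x + ts/(1 + t))² + s² t/(1 + t)`. -/
theorem integral_exp_neg_mul_add_sq_gaussianReal {t : ℝ} (ht : 0 ≤ t) (s : ℝ) :
    ∫ x, Real.exp (-(t * (s + x) ^ 2)) ∂gaussianReal 0 (1 / 2)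
      = (√(1 + t))⁻¹ * Real.exp (-(s ^ 2 * (t / (1 + t)))) := by
  have h0 : 1 + t ≠ 0 := by positivity
  rw [integral_gaussianReal_eq_integral_smul (by norm_num)]
  have hpt : ∀ x : ℝ, gaussianPDFReal 0 (1 / 2) x • Real.exp (-(t * (s + x) ^ 2))
      = ((√Real.pi)⁻¹ * Real.exp (-(s ^ 2 * (t / (1 + t)))))
        * Real.exp (-(1 + t) * (x + t * s / (1 + t)) ^ 2) := by
    intro x
    rw [gaussianPDFReal, smul_eq_mul, mul_assoc, ← Real.exp_add, mul_assoc (√Real.pi)⁻¹,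
      ← Real.exp_add]
    congr 2
    · rw [show 2 * Real.pi * ((1 / 2 : NNReal) : ℝ) = Real.pi by
        rw [NNReal.coe_div, NNReal.coe_one, NNReal.coe_ofNat]
        ring]
    · norm_num
      field_simp
      ring
  simp only [hpt]
  rw [integral_const_mul, integral_add_right_eq_self
    (fun x : ℝ => Real.exp (-(1 + t) * x ^ 2)), integral_gaussian, Real.sqrt_div Real.pi_pos.le]
  have h1 : √Real.pi ≠ 0 := (Real.sqrt_pos.2 Real.pi_pos).ne'
  field_simp

theorem norm_add_mk_sq (s : ℂ) (x y : ℝ) :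
    ‖s + (⟨x, y⟩ : ℂ)‖ ^ 2 = (s.re + x) ^ 2 + (s.im + y) ^ 2 := by
  rw [Complex.sq_norm, Complex.normSq_apply]
  simp
  ring

/-- Laplace transform of the noncentral chi-squared law with two degrees of freedom. -/
theorem integral_exp_neg_mul_norm_add_sq_cscg {t : ℝ} (ht : 0 ≤ t) (s : ℂ) :
    ∫ z, Real.exp (-(t * ‖s + z‖ ^ 2)) ∂cscg 0 1
      = (1 + t)⁻¹ * Real.exp (-(‖s‖ ^ 2 * (t / (1 + t)))) := by
  rw [integral_cscg (by fun_prop)]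
  simp only [norm_add_mk_sq, mul_add, neg_add, Real.exp_add]
  rw [integral_prod_mul (fun x : ℝ => Real.exp (-(t * (s.re + x) ^ 2)))
    (fun y : ℝ => Real.exp (-(t * (s.im + y) ^ 2))), integral_exp_neg_mul_add_sq_gaussianReal ht,
    integral_exp_neg_mul_add_sq_gaussianReal ht, mul_mul_mul_comm, ← Real.exp_add, ← mul_inv,
    Real.mul_self_sqrt (by positivity), Complex.sq_norm, Complex.normSq_apply]
  congr 2
  ring

theorem integrable_add_sq_gaussianReal (s : ℝ) (v : NNReal) :
    Integrable (fun x => (s + x) ^ 2) (gaussianReal 0 v) := by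
  have h1 : MemLp (fun x : ℝ => s + x) 2 (gaussianReal 0 v) :=
    (memLp_const s).add (memLp_id_gaussianReal 2)
  exact h1.integrable_sq

theorem integral_add_sq_gaussianReal (s : ℝ) (v : NNReal) :
    ∫ x, (s + x) ^ 2 ∂gaussianReal 0 v = s ^ 2 + v := by
  have h1 : MemLp id 2 (gaussianReal 0 v) := memLp_id_gaussianReal 2
  have h2 : Integrable (fun x : ℝ => x) (gaussianReal 0 v) := h1.integrable (by norm_num)
  have h3 : Integrable (fun x : ℝ => x ^ 2) (gaussianReal 0 v) := h1.integrable_sq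
  have h4 : ∫ x, x ^ 2 ∂gaussianReal 0 v = v := by
    have := variance_eq_sub h1
    simpa using this.symm
  simp only [add_sq]
  rw [integral_add (f := fun x : ℝ => s ^ 2 + 2 * s * x)
    ((integrable_const _).add (h2.const_mul _)) h3,
    integral_add (integrable_const _) (h2.const_mul _),
    integral_const_mul, integral_id_gaussianReal, h4]
  simp

theorem integrable_norm_add_sq_cscg (s : ℂ) :
    Integrable (fun z => ‖s + z‖ ^ 2) (cscg 0 1) := by
  rw [cscg, integrable_map_measure (Measurable.aestronglyMeasurable (by fun_prop))
    measurable_complex_mk.aemeasurable]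
  simp only [Function.comp_def, norm_add_mk_sq]
  exact ((integrable_add_sq_gaussianReal s.re _).comp_fst _).add
    ((integrable_add_sq_gaussianReal s.im _).comp_snd _)

theorem integral_norm_add_sq_cscg (s : ℂ) :
    ∫ z, ‖s + z‖ ^ 2 ∂cscg 0 1 = ‖s‖ ^ 2 + 1 := by
  rw [integral_cscg (by fun_prop)]
  simp only [norm_add_mk_sq]
  rw [integral_add ((integrable_add_sq_gaussianReal s.re _).comp_fst _)
    ((integrable_add_sq_gaussianReal s.im _).comp_snd _),
    integral_fun_fst (fun x : ℝ => (s.re + x) ^ 2), integral_fun_snd (fun x : ℝ => (s.im + x) ^ 2),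
    integral_add_sq_gaussianReal, integral_add_sq_gaussianReal, Complex.sq_norm,
    Complex.normSq_apply]
  norm_num
  ring

theorem memLp_norm_add_cscg (s : ℂ) : MemLp (fun z => ‖s + z‖) 2 (cscg 0 1) :=
  (memLp_two_iff_integrable_sq (Measurable.aestronglyMeasurable (by fun_prop))).2
    (integrable_norm_add_sq_cscg s)

/-- Mean of the Rice distribution. -/
theorem integral_norm_add_cscg (s : ℂ) :
    ∫ z, ‖s + z‖ ∂cscg 0 1 = √Real.pi / 2 * laguerreL (1 / 2) (-‖s‖ ^ 2) := by
  let f : ℂ → ℝ → ℝ := fun z x => (1 - Real.exp (-(‖s + z‖ ^ 2 * x ^ 2))) / x ^ 2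
  have hpi : √Real.pi ≠ 0 := (Real.sqrt_pos.2 Real.pi_pos).ne'
  have hinner : ∀ z, ∫ x in Set.Ioi 0, f z x = √Real.pi * ‖s + z‖ := fun z => by
    rw [integral_one_sub_exp_neg_mul_sq_div_sq (sq_nonneg _), Real.sqrt_mul Real.pi_pos.le,
      Real.sqrt_sq (norm_nonneg _)]
  have hnonneg : ∀ z x, 0 ≤ f z x := fun z x =>
    one_sub_exp_neg_mul_sq_div_sq_nonneg (sq_nonneg _) x
  -- As `f` is nonnegative, Tonelli reduces this to integrability of the inner integral `√π ‖s +
  -- z‖`.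
  have hint : Integrable (Function.uncurry f)
      ((cscg 0 1).prod (volume.restrict (Set.Ioi (0 : ℝ)))) := by
    rw [integrable_prod_iff (Measurable.aestronglyMeasurable
      (by simp only [f, Function.uncurry_def]; fun_prop))]
    refine ⟨Filter.Eventually.of_forall fun z =>
      (integrable_one_sub_exp_neg_mul_sq_div_sq (sq_nonneg ‖s + z‖)).integrableOn, ?_⟩
    simp only [Function.uncurry_apply_pair, Real.norm_of_nonneg (hnonneg _ _), hinner]
    exact ((memLp_norm_add_cscg s).integrable (by norm_num)).const_mul _
  have hswap := integral_integral_swap hint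
  simp only [hinner, integral_const_mul] at hswap
  have houter : ∀ x : ℝ, ∫ z, f z x ∂cscg 0 1
      = (1 - (1 + x ^ 2)⁻¹ * Real.exp (-(‖s‖ ^ 2 * (x ^ 2 / (1 + x ^ 2))))) / x ^ 2 := fun x => by
    have hexp : Integrable (fun z => Real.exp (-(x ^ 2 * ‖s + z‖ ^ 2))) (cscg 0 1) := by
      refine (integrable_const (1 : ℝ)).mono' (Measurable.aestronglyMeasurable (by fun_prop))
        (Filter.Eventually.of_forall fun z => ?_)
      rw [Real.norm_of_nonneg (Real.exp_pos _).le]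
      exact Real.exp_le_one_iff.2 (neg_nonpos.2 (by positivity))
    simp only [f, mul_comm _ (x ^ 2)]
    rw [integral_div, integral_sub (integrable_const _) hexp,
      integral_exp_neg_mul_norm_add_sq_cscg (sq_nonneg x)]
    simp
  simp only [houter] at hswap
  rw [integral_one_sub_exp_div_sq_eq_laguerreL (sq_nonneg _)] at hswap
  refine mul_left_cancel₀ hpi (hswap.trans ?_)
  rw [← mul_assoc, mul_div_assoc', Real.mul_self_sqrt Real.pi_pos.le]

/-! ### Rician and Rayleigh links -/

theorem laguerreL_zero (ν : ℝ) : laguerreL ν 0 = 1 := by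
  rw [laguerreL, tsum_eq_single 0 fun n hn => by simp [hn]]
  simp

/-- Reduces a Rician link to the Rice law with shift `√κ w`, whose squared modulus is `κ` when `‖w‖
= 1`. -/
theorem norm_rician_eq {δ κ : ℝ} (hκ : 0 ≤ κ) (w z : ℂ) :
    ‖(√δ : ℂ) * (√(κ / (κ + 1)) * w + √(1 / (κ + 1)) * z)‖ = √δ * √(1 / (κ + 1)) * ‖√κ * w + z‖ := by
  have h1 : √(κ / (κ + 1)) = √(1 / (κ + 1)) * √κ := by
    rw [← Real.sqrt_mul (by positivity), one_div_mul_eq_div]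
  have h2 : (√(κ / (κ + 1)) * w + √(1 / (κ + 1)) * z : ℂ) = √(1 / (κ + 1)) * (√κ * w + z) := by
    rw [h1]
    push_cast
    ring
  rw [h2, norm_mul, norm_mul, Complex.norm_of_nonneg (Real.sqrt_nonneg _),
    Complex.norm_of_nonneg (Real.sqrt_nonneg _), mul_assoc]

theorem norm_sqrt_mul_sq {κ : ℝ} (hκ : 0 ≤ κ) {w : ℂ} (hw : ‖w‖ = 1) : ‖√κ * w‖ ^ 2 = κ := by
  rw [norm_mul, hw, mul_one, Complex.norm_of_nonneg (Real.sqrt_nonneg _), Real.sq_sqrt hκ]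

theorem memLp_norm_rician_cscg {δ κ : ℝ} (hκ : 0 ≤ κ) (w : ℂ) :
    MemLp (fun z : ℂ => ‖(√δ : ℂ) * (√(κ / (κ + 1)) * w + √(1 / (κ + 1)) * z)‖) 2 (cscg 0 1) := by
  simp only [norm_rician_eq hκ]
  exact (memLp_norm_add_cscg _).const_mul _

theorem integral_norm_rician_cscg {δ κ : ℝ} (hκ : 0 ≤ κ) {w : ℂ} (hw : ‖w‖ = 1) :
    ∫ z : ℂ, ‖(√δ : ℂ) * (√(κ / (κ + 1)) * w + √(1 / (κ + 1)) * z)‖ ∂cscg 0 1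
      = √δ * √(1 / (κ + 1)) * (√Real.pi / 2 * laguerreL (1 / 2) (-κ)) := by
  simp only [norm_rician_eq hκ]
  rw [integral_const_mul, integral_norm_add_cscg, norm_sqrt_mul_sq hκ hw]

theorem integral_norm_rician_sq_cscg {δ κ : ℝ} (hδ : 0 ≤ δ) (hκ : 0 ≤ κ) {w : ℂ} (hw : ‖w‖ = 1) :
    ∫ z : ℂ, ‖(√δ : ℂ) * (√(κ / (κ + 1)) * w + √(1 / (κ + 1)) * z)‖ ^ 2 ∂cscg 0 1 = δ := by
  simp only [norm_rician_eq hκ, mul_pow]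
  rw [integral_const_mul, integral_norm_add_sq_cscg, norm_sqrt_mul_sq hκ hw, Real.sq_sqrt hδ,
    Real.sq_sqrt (by positivity)]
  field_simp

theorem memLp_norm_rayleigh_cscg (δ : ℝ) : MemLp (fun z : ℂ => ‖(√δ : ℂ) * z‖) 2 (cscg 0 1) := by
  simpa using memLp_norm_rician_cscg (δ := δ) le_rfl 1

theorem integral_norm_rayleigh_cscg (δ : ℝ) :
    ∫ z : ℂ, ‖(√δ : ℂ) * z‖ ∂cscg 0 1 = √δ * (√Real.pi / 2) := by
  simpa [laguerreL_zero] using integral_norm_rician_cscg (δ := δ) le_rfl (norm_one (α := ℂ))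

theorem integral_norm_rayleigh_sq_cscg {δ : ℝ} (hδ : 0 ≤ δ) :
    ∫ z : ℂ, ‖(√δ : ℂ) * z‖ ^ 2 ∂cscg 0 1 = δ := by
  simpa using integral_norm_rician_sq_cscg hδ le_rfl (norm_one (α := ℂ))

/-! ### Second moments under independence -/

theorem ProbabilityTheory.IndepFun.memLp_two_mul {Ω : Type*} [MeasurableSpace Ω] {P : Measure Ω}
    {X Y : Ω → ℝ} (h : IndepFun X Y P) (hX : MemLp X 2 P) (hY : MemLp Y 2 P) :
    MemLp (X * Y) 2 P := by
  rw [memLp_two_iff_integrable_sq (hX.1.mul hY.1)]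
  have h2 := (h.comp (measurable_id.pow_const 2) (measurable_id.pow_const 2)).integrable_mul
    hX.integrable_sq hY.integrable_sq
  exact h2.congr (Filter.Eventually.of_forall fun ω => by simp [mul_pow])

theorem ProbabilityTheory.IndepFun.integral_mul_sq {Ω : Type*} [MeasurableSpace Ω] {P : Measure Ω}
    {X Y : Ω → ℝ} (h : IndepFun X Y P) (hX : MemLp X 2 P) (hY : MemLp Y 2 P) :
    ∫ ω, (X * Y) ω ^ 2 ∂P = (∫ ω, X ω ^ 2 ∂P) * ∫ ω, Y ω ^ 2 ∂P := by
  have h2 := (h.comp (measurable_id.pow_const 2)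
    (measurable_id.pow_const 2)).integral_mul_eq_mul_integral
    hX.integrable_sq.1 hY.integrable_sq.1
  simpa [mul_pow] using h2

/-- Second moment of `Y none + ∑ i ∈ s, Y (some i)` for pairwise independent square-integrable
summands, those indexed by `s` having common first and second moments. -/
theorem integral_add_sum_sq_of_indepFun {Ω ι : Type*} [MeasurableSpace Ω] {P : Measure Ω}
    [IsProbabilityMeasure P] {Y : Option ι → Ω → ℝ} (s : Finset ι) (hY : ∀ o, MemLp (Y o) 2 P)
    (hind : Pairwise fun i j => IndepFun (Y i) (Y j) P) {μ σ : ℝ}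
    (hμ : ∀ i, ∫ ω, Y (some i) ω ∂P = μ) (hσ : ∀ i, ∫ ω, Y (some i) ω ^ 2 ∂P = σ) :
    Integrable (fun ω => (Y none ω + ∑ i ∈ s, Y (some i) ω) ^ 2) P ∧
    ∫ ω, (Y none ω + ∑ i ∈ s, Y (some i) ω) ^ 2 ∂P
      = ∫ ω, Y none ω ^ 2 ∂P + s.card * σ + s.card * (s.card - 1) * μ ^ 2
        + 2 * s.card * (∫ ω, Y none ω ∂P) * μ := by
  have hsum : ∀ ω, Y none ω + ∑ i ∈ s, Y (some i) ω = (∑ o ∈ s.insertNone, Y o) ω := fun ω => by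
    rw [Finset.sum_apply, Finset.sum_insertNone]
  have hL : MemLp (∑ o ∈ s.insertNone, Y o) 2 P := memLp_finsetSum' _ fun o _ => hY o
  simp only [hsum]
  refine ⟨hL.integrable_sq, ?_⟩
  -- Pairwise independence makes variances add; restoring the squared mean produces the cross terms.
  have hvar := IndepFun.variance_sum (s := s.insertNone) (fun o _ => hY o)
    (fun i _ j _ hij => hind hij)
  rw [variance_eq_sub hL, Finset.sum_insertNone (fun o => variance (Y o) P),
    variance_eq_sub (hY none)] at hvar
  simp only [variance_eq_sub (hY (some _)), Pi.pow_apply, hμ, hσ, Finset.sum_const,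
    nsmul_eq_mul] at hvar
  have hmean : ∫ ω, (∑ o ∈ s.insertNone, Y o) ω ∂P = (∫ ω, Y none ω ∂P) + s.card * μ := by
    simp only [Finset.sum_apply]
    rw [integral_finsetSum _ fun o _ => (hY o).integrable (by norm_num), Finset.sum_insertNone]
    simp [hμ]
  rw [hmean] at hvar
  linear_combination hvar

/-! ### Aligned channel and its path moduli -/

namespace StarRIS

variable {Ω : Type*} {K M : ℕ} (S : StarRIS K M) (F : Fading Ω K M)

/-- On the user's own subsurface the amplitude is `1` and the phase of `q` cancels. The polar form
also covers zero values, so no exceptional set arises. -/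
theorem channel_eq (k : Fin K) (ω : Ω) :
    S.channel F k ω = Complex.exp (Complex.I * (S.h F k ω).arg) * S.c F k ω := by
  have hh : S.h F k ω = Complex.exp (Complex.I * (S.h F k ω).arg) * ‖S.h F k ω‖ := by
    rw [mul_comm, mul_comm Complex.I, Complex.norm_mul_exp_arg_mul_I]
  have hq : ∀ m ∈ S.subsurface k, S.q F k m ω * S.v F (S.side k) m ω
      = Complex.exp (Complex.I * (S.h F k ω).arg) * ‖S.q F k m ω‖ := by
    intro m hm
    have hm' : S.owner m = k := (Finset.mem_filter.1 hm).2
    simp only [v, θ, β, hm', if_true, Real.sqrt_one, Complex.ofReal_one, one_mul,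
      Complex.ofReal_sub, mul_sub, Complex.exp_sub]
    nth_rw 1 [← Complex.norm_mul_exp_arg_mul_I (S.q F k m ω)]
    rw [mul_comm Complex.I (Complex.ofReal (S.q F k m ω).arg)]
    have := Complex.exp_ne_zero ((S.q F k m ω).arg * Complex.I)
    field_simp
  rw [channel, via, Finset.sum_congr rfl hq, c]
  nth_rw 1 [hh]
  push_cast
  rw [mul_add, Finset.mul_sum]

/-- The modulus of each link of user `k`, as a function of its fading coefficient. -/
noncomputable def amplitude (k : Fin K) : Unit ⊕ Fin M ⊕ Fin M → ℂ → ℝ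
  | Sum.inl _, z => ‖(√(S.δ k) : ℂ) * z‖
  | Sum.inr (Sum.inl m), z =>
    ‖(√S.δBS : ℂ) * (√(S.κ₁ / (S.κ₁ + 1)) * S.gLoS m + √(1 / (S.κ₁ + 1)) * z)‖
  | Sum.inr (Sum.inr m), z =>
    ‖(√(S.δS k) : ℂ) * (√(S.κ₂ / (S.κ₂ + 1)) * S.rLoS k m + √(1 / (S.κ₂ + 1)) * z)‖

theorem measurable_amplitude (k : Fin K) : ∀ i, Measurable (S.amplitude k i)
  | Sum.inl _ => by unfold amplitude; fun_prop
  | Sum.inr (Sum.inl m) => by unfold amplitude; fun_prop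
  | Sum.inr (Sum.inr m) => by unfold amplitude; fun_prop

theorem memLp_amplitude (k : Fin K) : ∀ i, MemLp (S.amplitude k i) 2 (cscg 0 1)
  | Sum.inl _ => memLp_norm_rayleigh_cscg _
  | Sum.inr (Sum.inl _) => memLp_norm_rician_cscg S.κ₁_nonneg _
  | Sum.inr (Sum.inr _) => memLp_norm_rician_cscg S.κ₂_nonneg _

/-- The modulus of each link of user `k` on the sample space. -/
noncomputable def linkNorm (k : Fin K) (i : Unit ⊕ Fin M ⊕ Fin M) : Ω → ℝ :=
  S.amplitude k i ∘ F.forUser k i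

/-- The moduli of the direct link (`none`) and of the cascaded links (`some m`) of user `k`. -/
noncomputable def pathNorm (k : Fin K) : Option (Fin M) → Ω → ℝ
  | none => S.linkNorm F k (Sum.inl ())
  | some m => S.linkNorm F k (Sum.inr (Sum.inr m)) * S.linkNorm F k (Sum.inr (Sum.inl m))

theorem c_eq_pathNorm (k : Fin K) (ω : Ω) :
    S.c F k ω = S.pathNorm F k none ω + ∑ m ∈ S.subsurface k, S.pathNorm F k (some m) ω := by
  simp only [c, q, norm_mul, RCLike.norm_conj]
  simp only [h, r, g, pathNorm, Pi.mul_apply, linkNorm, amplitude, Function.comp_apply,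
    Fading.forUser]

variable [MeasurableSpace Ω] {P : Measure Ω} {F}

theorem iIndepFun_linkNorm (hF : F.IsCSCG P) (k : Fin K) : iIndepFun (S.linkNorm F k) P :=
  (hF.indep k).comp _ (S.measurable_amplitude k)

theorem memLp_linkNorm (hF : F.IsCSCG P) (k : Fin K) (i) : MemLp (S.linkNorm F k i) 2 P := by
  have h1 := S.memLp_amplitude k i
  rw [← (hF.law k i).map_eq] at h1
  exact (memLp_map_measure_iff h1.1 (hF.law k i).aemeasurable).1 h1

theorem integral_linkNorm (hF : F.IsCSCG P) (k : Fin K) (i) :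
    ∫ ω, S.linkNorm F k i ω ∂P = ∫ z, S.amplitude k i z ∂cscg 0 1 :=
  (hF.law k i).integral_comp (S.measurable_amplitude k i).aestronglyMeasurable

theorem integral_linkNorm_sq (hF : F.IsCSCG P) (k : Fin K) (i) :
    ∫ ω, S.linkNorm F k i ω ^ 2 ∂P = ∫ z, S.amplitude k i z ^ 2 ∂cscg 0 1 :=
  (hF.law k i).integral_comp ((S.measurable_amplitude k i).pow_const 2).aestronglyMeasurable

theorem indepFun_linkNorm (hF : F.IsCSCG P) (k : Fin K) (m : Fin M) :
    IndepFun (S.linkNorm F k (Sum.inr (Sum.inr m))) (S.linkNorm F k (Sum.inr (Sum.inl m))) P :=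
  (S.iIndepFun_linkNorm hF k).indepFun (by simp)

theorem memLp_pathNorm (hF : F.IsCSCG P) (k : Fin K) : ∀ o, MemLp (S.pathNorm F k o) 2 P
  | none => S.memLp_linkNorm hF k _
  | some m => (S.indepFun_linkNorm hF k m).memLp_two_mul (S.memLp_linkNorm hF k _)
      (S.memLp_linkNorm hF k _)

/-- Distinct paths involve disjoint sets of mutually independent coefficients. -/
theorem pairwise_indepFun_pathNorm (hF : F.IsCSCG P) (k : Fin K) :
    Pairwise fun i j => IndepFun (S.pathNorm F k i) (S.pathNorm F k j) P := by
  have hi := S.iIndepFun_linkNorm hF k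
  have hm : ∀ i, AEMeasurable (S.linkNorm F k i) P := fun i =>
    (S.memLp_linkNorm hF k i).1.aemeasurable
  rintro (_ | m) (_ | n) hne
  · exact absurd rfl hne
  · exact hi.indepFun_mul_right₀ hm _ _ _ (by simp) (by simp)
  · exact hi.indepFun_mul_left₀ hm _ _ _ (by simp) (by simp)
  · have hmn : m ≠ n := fun e => hne (congrArg some e)
    exact hi.indepFun_mul_mul₀ hm _ _ _ _ (by simpa using hmn) (by simp) (by simp)
      (by simpa using hmn)

theorem integral_pathNorm_none (hF : F.IsCSCG P) (k : Fin K) :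
    ∫ ω, S.pathNorm F k none ω ∂P = √(S.δ k) * (√Real.pi / 2) :=
  (S.integral_linkNorm hF k _).trans (integral_norm_rayleigh_cscg _)

theorem integral_pathNorm_none_sq (hF : F.IsCSCG P) (k : Fin K) :
    ∫ ω, S.pathNorm F k none ω ^ 2 ∂P = S.δ k :=
  (S.integral_linkNorm_sq hF k _).trans (integral_norm_rayleigh_sq_cscg (S.δ_nonneg k))

/-- Unit-modulus line-of-sight components make the mean independent of `m`. -/
theorem integral_pathNorm_some (hF : F.IsCSCG P) (k : Fin K) (m : Fin M) :
    ∫ ω, S.pathNorm F k (some m) ω ∂P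
      = √(S.δS k) * √(1 / (S.κ₂ + 1)) * (√Real.pi / 2 * laguerreL (1 / 2) (-S.κ₂))
        * (√S.δBS * √(1 / (S.κ₁ + 1)) * (√Real.pi / 2 * laguerreL (1 / 2) (-S.κ₁))) := by
  refine ((S.indepFun_linkNorm hF k m).integral_mul_eq_mul_integral
    (S.memLp_linkNorm hF k _).1 (S.memLp_linkNorm hF k _).1).trans ?_
  rw [integral_linkNorm S hF, integral_linkNorm S hF]
  exact congrArg₂ (· * ·) (integral_norm_rician_cscg S.κ₂_nonneg (S.norm_rLoS k m))
    (integral_norm_rician_cscg S.κ₁_nonneg (S.norm_gLoS m))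

theorem integral_pathNorm_some_sq (hF : F.IsCSCG P) (k : Fin K) (m : Fin M) :
    ∫ ω, S.pathNorm F k (some m) ω ^ 2 ∂P = S.δS k * S.δBS := by
  refine ((S.indepFun_linkNorm hF k m).integral_mul_sq
    (S.memLp_linkNorm hF k _) (S.memLp_linkNorm hF k _)).trans ?_
  rw [integral_linkNorm_sq S hF, integral_linkNorm_sq S hF]
  exact congrArg₂ (· * ·)
    (integral_norm_rician_sq_cscg (S.δS_nonneg k) S.κ₂_nonneg (S.norm_rLoS k m))
    (integral_norm_rician_sq_cscg S.δBS_nonneg S.κ₁_nonneg (S.norm_gLoS m))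

end StarRIS

/-! ### Expected channel power gain -/

theorem lemma3 {Ω : Type*} [MeasurableSpace Ω] (P : Measure Ω) [IsProbabilityMeasure P]
    {K M : ℕ} (S : StarRIS K M) (F : Fading Ω K M) (hF : F.IsCSCG P) (k : Fin K) :
    (∀ ω, S.channel F k ω = Complex.exp (Complex.I * (S.h F k ω).arg) * S.c F k ω) ∧
    Integrable (fun ω => S.c F k ω ^ 2) P ∧
    ∫ ω, S.c F k ω ^ 2 ∂P =
      S.δ k + S.δBS * S.δS k * S.size k
        + Real.pi ^ 2 * S.δBS * S.δS k * S.size k * ((S.size k : ℝ) - 1)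
            / (16 * (S.κ₁ + 1) * (S.κ₂ + 1))
          * (laguerreL (1 / 2) (-S.κ₁) * laguerreL (1 / 2) (-S.κ₂)) ^ 2
        + √(Real.pi ^ 3 * S.δ k * S.δBS * S.δS k / (16 * (S.κ₁ + 1) * (S.κ₂ + 1)))
          * laguerreL (1 / 2) (-S.κ₁) * laguerreL (1 / 2) (-S.κ₂) * S.size k := by

  obtain ⟨hint, hval⟩ := integral_add_sum_sq_of_indepFun (S.subsurface k)
    (S.memLp_pathNorm hF k) (S.pairwise_indepFun_pathNorm hF k)
    (S.integral_pathNorm_some hF k) (S.integral_pathNorm_some_sq hF k)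
  simp only [← S.c_eq_pathNorm F k] at hint hval
  refine ⟨S.channel_eq F k, hint, hval.trans ?_⟩
  rw [S.integral_pathNorm_none hF, S.integral_pathNorm_none_sq hF, ← StarRIS.size]
  have hδ := S.δ_nonneg k
  have hδS := S.δS_nonneg k
  have hδBS := S.δBS_nonneg
  have hκ₁ : 0 < S.κ₁ + 1 := by linarith [S.κ₁_nonneg]
  have hκ₂ : 0 < S.κ₂ + 1 := by linarith [S.κ₂_nonneg]
  -- This matches the cross term: three factors `√π / 2`, one per link, and the binomial `2` give
  -- `√π³ / 4`.
  have hsqrt : √(Real.pi ^ 3 * S.δ k * S.δBS * S.δS k / (16 * (S.κ₁ + 1) * (S.κ₂ + 1)))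
      = √Real.pi ^ 3 / 4 * √(S.δ k) * √S.δBS * √(S.δS k) * √(1 / (S.κ₁ + 1))
        * √(1 / (S.κ₂ + 1)) := by
    refine (Real.sqrt_eq_iff_mul_self_eq (by positivity) (by positivity)).2 ?_
    have e1 := Real.mul_self_sqrt Real.pi_pos.le
    have e2 := Real.mul_self_sqrt hδ
    have e3 := Real.mul_self_sqrt hδBS
    have e4 := Real.mul_self_sqrt hδS
    have e5 := Real.mul_self_sqrt (one_div_nonneg.2 hκ₁.le)
    have e6 := Real.mul_self_sqrt (one_div_nonneg.2 hκ₂.le)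
    symm
    calc _ = (√Real.pi * √Real.pi) ^ 3 / 16 * (√(S.δ k) * √(S.δ k)) * (√S.δBS * √S.δBS)
          * (√(S.δS k) * √(S.δS k)) * (√(1 / (S.κ₁ + 1)) * √(1 / (S.κ₁ + 1)))
          * (√(1 / (S.κ₂ + 1)) * √(1 / (S.κ₂ + 1))) := by ring
      _ = _ := by
        rw [e1, e2, e3, e4, e5, e6]
        field_simp
  rw [hsqrt]
  simp only [mul_pow, div_pow, Real.sq_sqrt hδS, Real.sq_sqrt hδBS, Real.sq_sqrt Real.pi_pos.le,
    Real.sq_sqrt (one_div_nonneg.2 hκ₁.le), Real.sq_sqrt (one_div_nonneg.2 hκ₂.le)]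
  field_simp
  ring
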